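/- Let $A$ be a commutative Noetherian local ring and let $\mathscr P=\operatorname{proj}A$ be the category of finitely generated projective (i.e. free) $A$-modules. Let $\mathbf K\mathscr P$ be the homotopy category of $\mathbb Z$-indexed complexes $\cdots\to C_{n+1}\to C_n\to C_{n-1}\to\cdots$ in $\mathscr P$. A complex $C$ in $\mathscr P$ is totally acyclic if the complexes of abelian groups $\operatorname{Hom}_{\mathscr P}(P,C)$ and $\operatorname{Hom}_{\mathscr P}(C,P)$ are acyclic for every $P\in\mathscr P$; it is eventually acyclic if for every $P\in\mathscr P$ one has $H_n(\operatorname{Hom}_{\mathscr P}(P,C))=0$ for $|n|\gg0$. Consider the following full subcategories of $\mathbf K\mathscr P$ (objects taken up to isomorphism in $\mathbf K\mathscr P$): $$\mathbf K_{\mathrm{tac}}\mathscr P=\{C\mid C\text{ totally acyclic}\},\qquad \mathbf K^{-,\mathrm b}\mathscr P=\{C\mid C_n=0\text{ for }n\ll0\text{ and }C\text{ eventually acyclic}\},\qquad \mathbf K^{\mathrm b}\mathscr P=\{C\mid C_n=0\text{ for }|n|\gg0\}.$$ Let $\mathbf D^{\mathrm b}_{\mathrm{st}}(A)=\mathbf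 K^{-,\mathrm b}\mathscr P/\mathbf K^{\mathrm b}\mathscr P$ be the Verdier quotient (the stable derived category of $A$), and let $$\beta_{\operatorname{proj}A}\colon\mathbf K_{\mathrm{tac}}(\operatorname{proj}A)\to\mathbf D^{\mathrm b}_{\mathrm{st}}(A)$$ be the functor induced by brutal truncation at degree zero: it sends a complex $C$ to $\cdots\to C_2\to C_1\to C_0\to0\to0\to\cdots$, and the homotopy class of a chain map $f$ to the image in the quotient of the truncation of $f$. If $\beta_{\operatorname{proj}A}$ is dense (i.e. every object of $\mathbf D^{\mathrm b}_{\mathrm{st}}(A)$ is isomorphic to $\beta_{\operatorname{proj}A}(T)$ for some totally acyclic complex $T$), then $A$ is Gorenstein, i.e. $A$ has finite injective dimension as a module over itself. -/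

import Mathlib

open CategoryTheory CategoryTheory.Limits

universe v u

namespace BrutalTruncation

section AdditiveCategory

variable {V : Type u} [Category.{v} V] [Preadditive V]

/-! A complex is indexed cohomologically: the object of a complex `C` that is written `C_n` in
homological notation is `C.X (-n)`. -/

/-- The complex of abelian groups `Hom(P, C)`. -/
noncomputable def homFrom (P : V) (C : CochainComplex V ℤ) : CochainComplex AddCommGrpCat.{v} ℤ :=
  ((preadditiveCoyoneda.obj (Opposite.op P)).mapHomologicalComplex (ComplexShape.up ℤ)).obj C

/-- The complex of abelian groups `Hom(C, P)`. -/
noncomputable def homTo (C : CochainComplex V ℤ) (P : V) :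
    HomologicalComplex AddCommGrpCat.{v} (ComplexShape.up ℤ).symm :=
  ((preadditiveYoneda.obj P).mapHomologicalComplex (ComplexShape.up ℤ).symm).obj C.op

/-- `C` is acyclic if `Hom(P, C)` is acyclic for all `P`. -/
def IsAcyclic (C : CochainComplex V ℤ) : Prop :=
  ∀ P : V, (homFrom P C).Acyclic

/-- `C` is totally acyclic if moreover `Hom(C, P)` is acyclic for all `P`. -/
def IsTotallyAcyclic (C : CochainComplex V ℤ) : Prop :=
  IsAcyclic C ∧ ∀ P : V, (homTo C P).Acyclic

/-- `C` is eventually acyclic if, for all `P`, the homology of `Hom(P, C)` vanishes in all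
degrees `n` with `|n|` large enough. -/
def IsEventuallyAcyclic (C : CochainComplex V ℤ) : Prop :=
  ∀ P : V, ∃ N : ℤ, ∀ n : ℤ, N ≤ |n| → (homFrom P C).ExactAt n

/-- `C_n = 0` for `n ≪ 0`, that is `C.X n = 0` for `n ≫ 0`. -/
def IsRightBounded (C : CochainComplex V ℤ) : Prop :=
  ∃ N : ℤ, ∀ n : ℤ, N ≤ n → IsZero (C.X n)

/-- `C_n = 0` for `|n| ≫ 0`. -/
def IsBounded (C : CochainComplex V ℤ) : Prop :=
  ∃ N : ℤ, ∀ n : ℤ, N ≤ |n| → IsZero (C.X n)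

variable (V) in
/-- The homotopy category of complexes in `V`. -/
abbrev K := HomotopyCategory V (ComplexShape.up ℤ)

/-- The objects of the homotopy category that are isomorphic in it to a complex with a
given property. -/
def upToIso (p : ObjectProperty (CochainComplex V ℤ)) : ObjectProperty (K V) := fun X =>
  ∃ C : CochainComplex V ℤ, p C ∧ Nonempty (X ≅ (HomotopyCategory.quotient V _).obj C)

variable (V) in
/-- The totally acyclic complexes in the homotopy category. -/
abbrev isKac : ObjectProperty (K V) := upToIso IsTotallyAcyclic

variable (V) in
/-- The right bounded eventually acyclic complexes in the homotopy category. -/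
abbrev isKminusb : ObjectProperty (K V) :=
  upToIso fun C => IsRightBounded C ∧ IsEventuallyAcyclic C

variable (V) in
/-- The bounded complexes in the homotopy category. -/
abbrev isKb : ObjectProperty (K V) := upToIso IsBounded

variable (V) in
/-- The homotopy category of totally acyclic complexes. -/
abbrev Kac := (isKac V).FullSubcategory

variable (V) in
/-- The homotopy category of right bounded eventually acyclic complexes. -/
abbrev Kminusb := (isKminusb V).FullSubcategory

lemma acyclic_of_homotopyEquiv {ι : Type*} {c : ComplexShape ι}
    {C D : HomologicalComplex AddCommGrpCat.{v} c} (e : HomotopyEquiv C D) (h : C.Acyclic) :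
    D.Acyclic := by
  intro i
  have h1 := (HomologicalComplex.exactAt_iff_isZero_homology _ _).1 (h i)
  rw [HomologicalComplex.exactAt_iff_isZero_homology]
  exact h1.of_iso (e.toHomologyIso i).symm

/-- Total acyclicity is invariant under homotopy equivalence. -/
lemma IsTotallyAcyclic.of_homotopyEquiv {C D : CochainComplex V ℤ} (e : HomotopyEquiv C D)
    (h : IsTotallyAcyclic C) : IsTotallyAcyclic D := by
  refine ⟨fun P => acyclic_of_homotopyEquiv
    ((preadditiveCoyoneda.obj (Opposite.op P)).mapHomotopyEquiv e) (h.1 P), fun P => ?_⟩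
  let e' : HomotopyEquiv ((HomologicalComplex.opFunctor V _).obj (Opposite.op C))
      ((HomologicalComplex.opFunctor V _).obj (Opposite.op D)) :=
    { hom := (HomologicalComplex.opFunctor V _).map e.inv.op
      inv := (HomologicalComplex.opFunctor V _).map e.hom.op
      homotopyHomInvId := (Homotopy.ofEq (Functor.map_comp _ _ _).symm).trans
        (e.homotopyHomInvId.op.trans (Homotopy.ofEq (CategoryTheory.Functor.map_id _ _)))
      homotopyInvHomId := (Homotopy.ofEq (Functor.map_comp _ _ _).symm).trans
        (e.homotopyInvHomId.op.trans (Homotopy.ofEq (CategoryTheory.Functor.map_id _ _))) }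
  exact acyclic_of_homotopyEquiv ((preadditiveYoneda.obj P).mapHomotopyEquiv e') (h.2 P)

lemma isTotallyAcyclic_as {X : K V} (h : isKac V X) : IsTotallyAcyclic X.as := by
  obtain ⟨C, hC, ⟨e⟩⟩ := h
  exact hC.of_homotopyEquiv (HomotopyCategory.homotopyEquivOfIso (C := C) (D := X.as) e.symm)

end AdditiveCategory

section Quotient

variable (V : Type u) [Category.{v} V] [Preadditive V] [HasZeroObject V] [HasBinaryBiproducts V]

/-- The morphisms of right bounded eventually acyclic complexes whose mapping cone (in the
homotopy category) is a bounded complex. -/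
def coneBounded : MorphismProperty (Kminusb V) :=
  (isKb V).trW.inverseImage (isKminusb V).ι

/-- The Verdier quotient of the right bounded eventually acyclic complexes by the bounded ones. -/
abbrev StableQuotient := (coneBounded V).Localization

end Quotient

section Truncation

open ComplexShape

variable {V : Type u} [Category.{v} V] [Preadditive V] [HasZeroObject V]

/-- The brutal truncation of a complex that keeps the degrees `i ≤ n` (that is, the
homological degrees `≥ -n`). -/
noncomputable abbrev trunc (n : ℤ) (C : CochainComplex V ℤ) : CochainComplex V ℤ :=
  C.stupidTrunc (embeddingUpIntLE n)

/-- The brutal truncation of a chain map. -/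
noncomputable abbrev truncMap (n : ℤ) {C D : CochainComplex V ℤ} (f : C ⟶ D) :
    trunc n C ⟶ trunc n D :=
  HomologicalComplex.stupidTruncMap f (embeddingUpIntLE n)

variable (n : ℤ) (C : CochainComplex V ℤ)

lemma isZero_trunc {i : ℤ} (hi : n < i) : IsZero ((trunc n C).X i) :=
  C.isZero_stupidTrunc_X _ _ ((notMem_range_embeddingUpIntLE_iff n i).2 hi)

/-- The brutal truncation agrees with `C` in the degrees `i ≤ n`. -/
noncomputable def truncXIso {i : ℤ} (hi : i ≤ n) : (trunc n C).X i ≅ C.X i :=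
  C.stupidTruncXIso (embeddingUpIntLE n) (i := (n - i).toNat) (by simp; lia)

lemma truncXIso_d {i j : ℤ} (hi : i ≤ n) (hj : j ≤ n) :
    (trunc n C).d i j ≫ (truncXIso n C hj).hom = (truncXIso n C hi).hom ≫ C.d i j := by
  have aux : ∀ (a b : ℕ) (ha : (embeddingUpIntLE n).f a = i) (hb : (embeddingUpIntLE n).f b = j),
      (trunc n C).d i j ≫ (C.stupidTruncXIso (embeddingUpIntLE n) hb).hom =
        (C.stupidTruncXIso (embeddingUpIntLE n) ha).hom ≫ C.d i j := by
    rintro a b rfl rfl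
    have h := (C.restriction (embeddingUpIntLE n)).extend_d_eq (embeddingUpIntLE n)
      (i := a) (j := b) rfl rfl
    change ((C.restriction (embeddingUpIntLE n)).extend (embeddingUpIntLE n)).d _ _ ≫
      (((C.restriction (embeddingUpIntLE n)).extendXIso (embeddingUpIntLE n) rfl).hom ≫ 𝟙 _) =
      (((C.restriction (embeddingUpIntLE n)).extendXIso (embeddingUpIntLE n) rfl).hom ≫ 𝟙 _) ≫ _
    rw [h, Category.comp_id, Category.comp_id, Category.assoc, Category.assoc, Iso.inv_hom_id,
      Category.comp_id]
    rfl
  exact aux _ _ _ _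

lemma truncXIso_d_assoc {i j : ℤ} (hi : i ≤ n) (hj : j ≤ n) {Z : V} (f : C.X j ⟶ Z) :
    (trunc n C).d i j ≫ (truncXIso n C hj).hom ≫ f = (truncXIso n C hi).hom ≫ C.d i j ≫ f := by
  rw [← Category.assoc, truncXIso_d n C hi hj, Category.assoc]

lemma truncMap_truncXIso {C D : CochainComplex V ℤ} (f : C ⟶ D) {i : ℤ} (hi : i ≤ n) :
    (truncMap n f).f i ≫ (truncXIso n D hi).hom = (truncXIso n C hi).hom ≫ f.f i :=
  HomologicalComplex.stupidTruncMap_stupidTruncXIso_hom f _ _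

lemma truncXIso_inv_d {i j : ℤ} (hi : i ≤ n) (hj : j ≤ n) :
    (truncXIso n C hi).inv ≫ (trunc n C).d i j = C.d i j ≫ (truncXIso n C hj).inv := by
  rw [Iso.inv_comp_eq, ← Category.assoc, Iso.eq_comp_inv, truncXIso_d]

lemma truncXIso_inv_truncMap {C D : CochainComplex V ℤ} (f : C ⟶ D) {i : ℤ} (hi : i ≤ n) :
    (truncXIso n C hi).inv ≫ (truncMap n f).f i = f.f i ≫ (truncXIso n D hi).inv := by
  rw [Iso.inv_comp_eq, ← Category.assoc, Iso.eq_comp_inv, truncMap_truncXIso]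

/-- The natural map from a brutal truncation to a smaller one. -/
noncomputable def truncProj {m : ℤ} (h : n ≤ m) : trunc m C ⟶ trunc n C where
  f i := if hi : i ≤ n then (truncXIso m C (hi.trans h)).hom ≫ (truncXIso n C hi).inv else 0
  comm' i j hij := by
    obtain rfl : i + 1 = j := hij
    by_cases hj : i + 1 ≤ n
    · have hi : i ≤ n := by lia
      rw [dif_pos hi, dif_pos hj, Category.assoc, truncXIso_inv_d n C hi hj,
        truncXIso_d_assoc m C (hi.trans h) (hj.trans h)]
    · exact (isZero_trunc n C (by lia)).eq_of_tgt _ _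

lemma truncProj_f {m : ℤ} (h : n ≤ m) {i : ℤ} (hi : i ≤ n) :
    (truncProj n C h).f i = (truncXIso m C (hi.trans h)).hom ≫ (truncXIso n C hi).inv :=
  dif_pos hi

variable {C} in
/-- A homotopy between two maps induces, after projecting from the truncation that keeps one
more degree, a homotopy between their truncations. -/
noncomputable def truncHomotopy {D : CochainComplex V ℤ} {f g : C ⟶ D} (h : Homotopy f g) :
    Homotopy (truncProj n C (Int.le_add_one le_rfl) ≫ truncMap n f)
      (truncProj n C (Int.le_add_one le_rfl) ≫ truncMap n g) where
  hom i j := if hij : i ≤ n + 1 ∧ j ≤ n then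
    (truncXIso (n + 1) C hij.1).hom ≫ h.hom i j ≫ (truncXIso n D hij.2).inv else 0
  zero i j hij := by
    split_ifs
    · rw [h.zero i j hij, zero_comp, comp_zero]
    · rfl
  comm i := by
    by_cases hi : i ≤ n
    · have h1 : (up ℤ).Rel i (i + 1) := rfl
      have h2 : (up ℤ).Rel (i - 1) i := by simp
      have hc := h.comm i
      rw [dNext_eq _ h1, prevD_eq _ h2] at hc
      rw [dNext_eq _ h1, prevD_eq _ h2, dif_pos ⟨by lia, hi⟩, dif_pos ⟨by lia, by lia⟩]
      simp only [HomologicalComplex.comp_f, truncProj_f n C _ hi, Category.assoc]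
      rw [truncXIso_inv_truncMap, truncXIso_inv_truncMap, hc,
        truncXIso_d_assoc (n + 1) C (by lia) (by lia), truncXIso_inv_d n D (by lia) hi]
      simp only [Preadditive.comp_add, Preadditive.add_comp, Category.assoc]
    · exact (isZero_trunc n D (by lia)).eq_of_tgt _ _

/-- The short complex `C.X (n + 1)[-(n + 1)] ⟶ trunc (n + 1) C ⟶ trunc n C`. -/
noncomputable def truncShortComplex : ShortComplex (CochainComplex V ℤ) :=
  ShortComplex.mk
    (HomologicalComplex.mkHomFromSingle (j := n + 1) (truncXIso (n + 1) C le_rfl).inv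
      (fun _ hk => (isZero_trunc (n + 1) C (by simp at hk; lia)).eq_of_tgt _ _))
    (truncProj n C (Int.le_add_one le_rfl)) (by
      refine HomologicalComplex.hom_ext _ _ fun i => ?_
      by_cases hi : i ≤ n
      · exact (HomologicalComplex.isZero_single_obj_X _ _ _ _ (by lia)).eq_of_src _ _
      · exact (isZero_trunc n C (by lia)).eq_of_tgt _ _)

/-- The short complex `truncShortComplex` is split exact in each degree. -/
noncomputable def truncShortComplexSplitting (i : ℤ) :
    ((truncShortComplex n C).map (HomologicalComplex.eval V _ i)).Splitting := by
  by_cases hi : i = n + 1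
  · refine ShortComplex.Splitting.ofIsIsoOfIsZero
      ((truncShortComplex n C).map (HomologicalComplex.eval V _ i)) ?_ (isZero_trunc n C (by lia))
    subst hi
    change IsIso ((HomologicalComplex.mkHomFromSingle (c := up ℤ) (truncXIso (n + 1) C le_rfl).inv
      (fun _ hk => (isZero_trunc (n + 1) C (by simp at hk; lia)).eq_of_tgt _ _)).f (n + 1))
    rw [HomologicalComplex.mkHomFromSingle_f]
    infer_instance
  · refine ShortComplex.Splitting.ofIsZeroOfIsIso
      ((truncShortComplex n C).map (HomologicalComplex.eval V _ i))
      (HomologicalComplex.isZero_single_obj_X (up ℤ) (n + 1) _ i hi) ?_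
    change IsIso ((truncProj n C (Int.le_add_one le_rfl)).f i)
    by_cases hi' : i ≤ n
    · rw [truncProj_f n C _ hi']
      infer_instance
    · exact (isZero_trunc (n + 1) C (by lia)).isIso (isZero_trunc n C (by lia)) _

lemma isRightBounded_trunc : IsRightBounded (trunc n C) :=
  ⟨n + 1, fun _ hi => isZero_trunc n C (by lia)⟩

variable {C} in
lemma isEventuallyAcyclic_trunc (hC : IsAcyclic C) : IsEventuallyAcyclic (trunc n C) := by
  intro P
  refine ⟨|n| + 1, fun i hi => ?_⟩
  by_cases h : n < i
  · exact HomologicalComplex.ExactAt.of_isZero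
      ((preadditiveCoyoneda.obj (Opposite.op P)).map_isZero (isZero_trunc n C h))
  · have hin : i + 1 ≤ n := by
      rcases abs_cases i with h1 | h1 <;> rcases abs_cases n with h2 | h2 <;> lia
    have hp : (up ℤ).prev i = i - 1 := by simp
    have hs : (up ℤ).next i = i + 1 := by simp
    have hex := hC P i
    rw [HomologicalComplex.exactAt_iff' _ _ _ _ hp hs] at hex ⊢
    let F := preadditiveCoyoneda.obj (Opposite.op P)
    refine (ShortComplex.exact_iff_of_iso ?_).2 hex
    refine ShortComplex.isoMk (F.mapIso (truncXIso n C (by lia)))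
      (F.mapIso (truncXIso n C (by lia))) (F.mapIso (truncXIso n C hin)) ?_ ?_
    · change F.map _ ≫ F.map _ = F.map _ ≫ F.map _
      rw [← F.map_comp, ← F.map_comp, truncXIso_d]
    · change F.map _ ≫ F.map _ = F.map _ ≫ F.map _
      rw [← F.map_comp, ← F.map_comp, truncXIso_d]

end Truncation

section Functor

variable (V : Type u) [Category.{v} V] [Preadditive V] [HasZeroObject V]

variable {V} in
/-- The brutal truncation of a totally acyclic complex, as an object of the right bounded
eventually acyclic complexes. -/
noncomputable def truncObj (n : ℤ) (X : Kac V) : Kminusb V :=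
  ⟨(HomotopyCategory.quotient V _).obj (trunc n X.obj.as), trunc n X.obj.as,
    ⟨isRightBounded_trunc n _, isEventuallyAcyclic_trunc n (isTotallyAcyclic_as X.property).1⟩,
    ⟨Iso.refl _⟩⟩

variable {V} in
/-- The brutal truncation of a chain map, as a morphism of right bounded eventually acyclic
complexes. -/
noncomputable def truncHom (n : ℤ) {X Y : Kac V} (f : X.obj.as ⟶ Y.obj.as) :
    truncObj n X ⟶ truncObj n Y :=
  ObjectProperty.homMk ((HomotopyCategory.quotient V _).map (truncMap n f))

variable {V} in
lemma truncHom_id (n : ℤ) (X : Kac V) : truncHom n (𝟙 X.obj.as) = 𝟙 (truncObj n X) := by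
  ext
  change (HomotopyCategory.quotient V _).map (HomologicalComplex.stupidTruncMap (𝟙 _) _) = _
  rw [HomologicalComplex.stupidTruncMap_id]
  exact CategoryTheory.Functor.map_id _ _

variable {V} in
lemma truncHom_comp (n : ℤ) {X Y Z : Kac V} (f : X.obj.as ⟶ Y.obj.as) (g : Y.obj.as ⟶ Z.obj.as) :
    truncHom n (f ≫ g) = truncHom n f ≫ truncHom n g := by
  ext
  change (HomotopyCategory.quotient V _).map (HomologicalComplex.stupidTruncMap (f ≫ g) _) = _
  rw [HomologicalComplex.stupidTruncMap_comp]
  exact CategoryTheory.Functor.map_comp _ _ _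

variable {V} in
/-- The natural map between two truncations. -/
noncomputable def truncObjProj (n : ℤ) (X : Kac V) : truncObj (n + 1) X ⟶ truncObj n X :=
  ObjectProperty.homMk ((HomotopyCategory.quotient V _).map
    (truncProj n X.obj.as (Int.le_add_one le_rfl)))

variable [HasBinaryBiproducts V]

variable {V} in
lemma truncObjProj_mem (n : ℤ) (X : Kac V) : coneBounded V (truncObjProj n X) := by
  have h := (HomotopyCategory.distinguished_iff_iso_trianglehOfDegreewiseSplit _).2
    ⟨truncShortComplex n X.obj.as, truncShortComplexSplitting n X.obj.as, ⟨Iso.refl _⟩⟩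
  have h' := Pretriangulated.rot_of_distTriang _ h
  refine ⟨_, _, _, h', ?_⟩
  refine ⟨((truncShortComplex n X.obj.as).X₁)⟦(1 : ℤ)⟧, ?_,
    ⟨((HomotopyCategory.quotient V _).commShiftIso (1 : ℤ)).symm.app _⟩⟩
  refine ⟨|n| + 1, fun i hi => ?_⟩
  refine HomologicalComplex.isZero_single_obj_X (ComplexShape.up ℤ) (n + 1) _ (i + 1) ?_
  rcases abs_cases i with h1 | h1 <;> rcases abs_cases n with h2 | h2 <;> lia

variable {V} in
lemma truncHom_eq_of_homotopy (n : ℤ) {X Y : Kac V} {f g : X.obj.as ⟶ Y.obj.as}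
    (h : Homotopy f g) :
    (coneBounded V).Q.map (truncHom n f) = (coneBounded V).Q.map (truncHom n g) := by
  have := (coneBounded V).Q_inverts _ (truncObjProj_mem n X)
  rw [← cancel_epi ((coneBounded V).Q.map (truncObjProj n X)), ← Functor.map_comp,
    ← Functor.map_comp]
  congr 1
  ext
  exact HomotopyCategory.eq_of_homotopy _ _ (truncHomotopy n h)

/-- The functor that brutal truncation at degree zero induces from the homotopy category of
totally acyclic complexes to the Verdier quotient: the class of a chain map `f` is sent to the
image of the truncation of `f`. -/
noncomputable def β : Kac V ⥤ StableQuotient V where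
  obj X := (coneBounded V).Q.obj (truncObj 0 X)
  map f := (coneBounded V).Q.map (truncHom 0 (Quot.out f.hom))
  map_id X := by
    rw [← CategoryTheory.Functor.map_id, ← truncHom_id]
    exact truncHom_eq_of_homotopy 0 (HomotopyCategory.homotopyOutMap (𝟙 X.obj.as))
  map_comp {X Y Z} f g := by
    rw [← CategoryTheory.Functor.map_comp, ← truncHom_comp]
    exact truncHom_eq_of_homotopy 0 (HomotopyCategory.homotopyOfEq _ _ (by
      rw [HomotopyCategory.quotient_map_out_comp_out]
      exact HomotopyCategory.quotient_map_out (f.hom ≫ g.hom)))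

/-- On the class of a chain map `f`, the functor is given by the truncation of `f`. -/
lemma β_map_quotient {X Y : Kac V} (f : X.obj.as ⟶ Y.obj.as) :
    (β V).map (X := X) (Y := Y) (ObjectProperty.homMk ((HomotopyCategory.quotient V _).map f)) =
      (coneBounded V).Q.map (truncHom 0 f) :=
  truncHom_eq_of_homotopy 0 (HomotopyCategory.homotopyOutMap f)

end Functor

section Modules

variable (A : Type u) [Ring A]

/-- The property of being a finitely generated projective module. -/
def isProj : ObjectProperty (ModuleCat.{u} A) := fun M => Module.Finite A M ∧ Module.Projective A M

/-- The category of finitely generated projective `A`-modules. -/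
abbrev Proj := (isProj A).FullSubcategory

instance : (isProj A).ContainsZero where
  exists_zero := ⟨ModuleCat.of A PUnit, ModuleCat.isZero_of_subsingleton _,
    ⟨inferInstanceAs (Module.Finite A PUnit.{u + 1}),
      inferInstanceAs (Module.Projective A PUnit.{u + 1})⟩⟩

instance : HasBinaryBiproducts (Proj A) where
  has_binary_biproduct X Y :=
    have := X.property.1
    have := X.property.2
    have := Y.property.1
    have := Y.property.2
    hasBinaryBiproduct_of_total
      { pt := ⟨ModuleCat.of A (X.obj × Y.obj), inferInstanceAs (Module.Finite A (X.obj × Y.obj)),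
          inferInstanceAs (Module.Projective A (X.obj × Y.obj))⟩
        fst := ObjectProperty.homMk (ModuleCat.ofHom (LinearMap.fst A X.obj Y.obj))
        snd := ObjectProperty.homMk (ModuleCat.ofHom (LinearMap.snd A X.obj Y.obj))
        inl := ObjectProperty.homMk (ModuleCat.ofHom (LinearMap.inl A X.obj Y.obj))
        inr := ObjectProperty.homMk (ModuleCat.ofHom (LinearMap.inr A X.obj Y.obj))
        inl_fst := by ext x; rfl
        inl_snd := by ext x; rfl
        inr_fst := by ext x; rfl
        inr_snd := by ext x; rfl }
      (by
        refine ObjectProperty.hom_ext _ (ModuleCat.hom_ext (LinearMap.ext fun x => ?_))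
        exact Prod.ext (add_zero x.1) (zero_add x.2))

/-- The stable derived category. -/
abbrev StableDerivedCategory := StableQuotient (Proj A)

/-- The functor from totally acyclic complexes of finitely generated projective modules to the
stable derived category that is induced by brutal truncation at degree zero. -/
noncomputable abbrev βProj : Kac (Proj A) ⥤ StableDerivedCategory A := β (Proj A)

end Modules

/-- A commutative local ring is Gorenstein if it has finite injective dimension as a module
over itself. -/
def IsGorensteinLocal (A : Type u) [CommRing A] [IsLocalRing A] : Prop :=
  ∃ n : ℕ, HasInjectiveDimensionLE (ModuleCat.of A A) n

end BrutalTruncation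

/-! A free resolution `C` of the residue field `k` lies in the right bounded eventually acyclic
complexes, so density makes it isomorphic, in the Verdier quotient, to a truncation of a totally
acyclic `T`. Homotopy classes of maps from that truncation to `A` placed in degree `i < 0` vanish,
because `Hom(T, A)` is exact. A morphism with bounded cone induces bijections on maps to `A` in
degree `i` for `i ≪ 0`, so vanishing for `i ≪ 0` is an invariant of the object of the quotient
(`eventually_subsingleton_hom_of_iso_localization`). Hence `Hom(C, A)` is exact far out
(`eventually_exact_of_essSurj`), that is, `Ext^i(k, A) = 0` for `i ≫ 0`.

The rest is commutative algebra: Noetherian induction on primes and Nakayama carry the vanishing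
from `k` to all finite modules (`subsingleton_ext_of_residueField`), and Baer's criterion with
dimension shifting turns it into finite injective dimension. -/

open Abelian

/-! ### Ext-vanishing: from the residue field to finite modules -/

section Ext

variable {A : Type u} [CommRing A]

lemma subsingleton_ext_middle {S : ShortComplex (ModuleCat.{u} A)} (hS : S.ShortExact)
    (M : ModuleCat.{u} A) (i : ℕ) (h₁ : Subsingleton (Ext S.X₁ M i))
    (h₃ : Subsingleton (Ext S.X₃ M i)) : Subsingleton (Ext S.X₂ M i) := by
  refine subsingleton_of_forall_eq 0 fun e => ?_
  obtain ⟨e', rfl⟩ := Ext.contravariant_sequence_exact₂ hS M e (Subsingleton.elim _ _)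
  rw [Subsingleton.elim e' 0, Ext.comp_zero]

variable [IsNoetherianRing A]

/-- Ext-vanishing passes from the quotients by the primes over an ideal to all finite modules
annihilated by this ideal. -/
lemma subsingleton_ext_of_le_annihilator (M : ModuleCat.{u} A) (i : ℕ) (J : Ideal A)
    (hJ : ∀ q : Ideal A, q.IsPrime → J ≤ q → Subsingleton (Ext (ModuleCat.of A (A ⧸ q)) M i))
    (N : Type u) [AddCommGroup N] [Module A N] [hN : Module.Finite A N]
    (hJN : J ≤ Module.annihilator A N) : Subsingleton (Ext (ModuleCat.of A N) M i) := by
  induction hN using IsNoetherianRing.induction_on_isQuotientEquivQuotientPrime A with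
  | subsingleton N =>
    have := (ModuleCat.isZero_of_subsingleton (ModuleCat.of A N)).hasProjectiveDimensionLT_zero
    exact HasProjectiveDimensionLT.subsingleton (ModuleCat.of A N) 0 i i.zero_le M
  | quotient N p e =>
    have hp := hJ p.1 p.2 (by rwa [e.annihilator_eq, Ideal.annihilator_quotient] at hJN)
    refine subsingleton_of_forall_eq 0 fun x => ?_
    rw [← Ext.mk₀_id_comp x, ← e.toModuleIso.hom_inv_id, ← Ext.mk₀_comp_mk₀,
      Ext.comp_assoc_of_second_deg_zero, Subsingleton.elim ((Ext.mk₀ e.toModuleIso.inv).comp x _) 0,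
      Ext.comp_zero]
  | exact N₁ N₂ N₃ f g hf hg hfg h₁ h₃ =>
    have hS : (ShortComplex.moduleCatMk f g hfg.linearMap_comp_eq_zero).ShortExact :=
      { exact := (ShortComplex.ShortExact.moduleCat_exact_iff_function_exact _).2 hfg
        mono_f := (ModuleCat.mono_iff_injective _).2 hf
        epi_g := (ModuleCat.epi_iff_surjective _).2 hg }
    exact subsingleton_ext_middle hS M i (h₁ (hJN.trans (f.annihilator_le_of_injective hf)))
      (h₃ (hJN.trans (g.annihilator_le_of_surjective hg)))

variable [IsLocalRing A]

open IsLocalRing in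
/-- A finite module with `Ext^i(k, M) = 0` for all `i ≥ n` has `Ext^i(N, M) = 0` for all `i ≥ n`
and all finite modules `N`. -/
lemma subsingleton_ext_of_residueField (M : ModuleCat.{u} A) [Module.Finite A M] (n : ℕ)
    (h : ∀ i, n ≤ i → Subsingleton (Ext (ModuleCat.of A (A ⧸ maximalIdeal A)) M i))
    (N : Type u) [AddCommGroup N] [Module A N] [hN : Module.Finite A N] (i : ℕ) (hi : n ≤ i) :
    Subsingleton (Ext (ModuleCat.of A N) M i) := by
  refine subsingleton_ext_of_le_annihilator M i ⊥ (fun q hq _ => ?_) N bot_le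
  -- The induction hypothesis for larger primes is needed in degree `i + 1`, so `i` must stay
  -- general.
  revert i
  induction q using IsNoetherian.induction with
  | hgt p ih =>
  intro i hi
  obtain rfl | hpm := (le_maximalIdeal hq.ne_top).eq_or_lt
  · exact h i hi
  obtain ⟨x, hxm, hxp⟩ := SetLike.exists_of_lt hpm
  have hreg : IsSMulRegular (A ⧸ p) x := by
    refine IsSMulRegular.of_right_eq_zero_of_smul fun y hy => ?_
    obtain ⟨y, rfl⟩ := Ideal.Quotient.mk_surjective y
    have : x * y ∈ p := Ideal.Quotient.eq_zero_iff_mem.1 hy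
    exact Ideal.Quotient.eq_zero_iff_mem.2 ((hq.mem_or_mem this).resolve_left hxp)
  have hS := hreg.smulShortComplex_shortExact (M := ModuleCat.of A (A ⧸ p))
  -- The quotient of `A ⧸ p` by `x` is killed by `p + (x)`, and every prime over that ideal is
  -- strictly larger than `p`.
  have zero : Subsingleton (Ext (ModuleCat.of A (QuotSMulTop x (A ⧸ p))) M (i + 1)) := by
    refine subsingleton_ext_of_le_annihilator M (i + 1) (p ⊔ Ideal.span {x})
      (fun q hq hJ =>
        ih q (lt_of_le_of_ne (le_sup_left.trans hJ) ?_) hq bot_le (i + 1) (hi.trans i.le_succ)) _ ?_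
    · rintro rfl
      exact hxp (hJ (Ideal.mem_sup_right (Ideal.mem_span_singleton_self x)))
    · refine sup_le ?_ ?_
      · refine le_trans ?_
          (LinearMap.annihilator_le_of_surjective (Submodule.mkQ _) (Submodule.mkQ_surjective _))
        rw [Ideal.annihilator_quotient]
      · rw [Ideal.span_singleton_le_iff_mem]
        exact QuotSMulTop.mem_annihilator _ x
  have smul_eq (z : Ext (ModuleCat.of A (A ⧸ p)) M i) :
      (Ext.mk₀ (x • 𝟙 (ModuleCat.of A (A ⧸ p)))).comp z (zero_add i) = x • z := by
    rw [Ext.mk₀_smul, Ext.smul_comp, Ext.mk₀_id_comp]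
  -- In the long exact sequence of multiplication by `x` on `A ⧸ p`, the term after `Ext^i(A ⧸ p,
  -- M)` is zero, so `x` acts surjectively on it.
  have div (y : Ext (ModuleCat.of A (A ⧸ p)) M i) : ∃ z, x • z = y := by
    obtain ⟨z, hz⟩ := Ext.contravariant_sequence_exact₁ hS M y (add_comm 1 i)
      (Subsingleton.elim (α := Ext (ModuleCat.of A (QuotSMulTop x (A ⧸ p))) M (i + 1)) _ _)
    exact ⟨z, (smul_eq z).symm.trans hz⟩
  have hfin : (⊤ : Submodule A (Ext (ModuleCat.of A (A ⧸ p)) M i)).FG := Module.Finite.fg_top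
  -- Nakayama: this Ext module is finite and equals its multiple by the maximal ideal, which
  -- contains `x`.
  have htop := Submodule.eq_bot_of_le_smul_of_le_jacobson_bot (maximalIdeal A) _ hfin
    (fun y _ => by
      obtain ⟨z, rfl⟩ := div y
      exact Submodule.smul_mem_smul hxm trivial) (maximalIdeal_le_jacobson _)
  exact subsingleton_of_forall_eq 0 fun y =>
    (Submodule.mem_bot A).1 (htop ▸ Submodule.mem_top)

end Ext

/-! ### Injective dimension via cyclic modules -/

section Baer

variable {A : Type u} [CommRing A]

/-- Finite injective dimension can be tested on the cyclic modules. -/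
lemma hasInjectiveDimensionLT_of_subsingleton_ext_quotient (n : ℕ) (M : ModuleCat.{u} A)
    (h : ∀ (I : Ideal A) (i : ℕ), n + 1 ≤ i → Subsingleton (Ext (ModuleCat.of A (A ⧸ I)) M i)) :
    HasInjectiveDimensionLT M (n + 1) := by
  induction n generalizing M with
  | zero =>
    have : Injective M := by
      refine @Module.injective_object_of_injective_module _ _ _ _ _ (Module.Baer.injective fun I g => ?_)
      have hS : (ShortComplex.moduleCatMk I.subtype I.mkQ
          (LinearMap.exact_subtype_mkQ I).linearMap_comp_eq_zero).ShortExact :=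
        { exact := (ShortComplex.ShortExact.moduleCat_exact_iff_function_exact _).2
            (LinearMap.exact_subtype_mkQ I)
          mono_f := (ModuleCat.mono_iff_injective _).2 I.injective_subtype
          epi_g := (ModuleCat.epi_iff_surjective _).2 I.mkQ_surjective }
      have := h I 1 le_rfl
      obtain ⟨x, hx⟩ := Ext.contravariant_sequence_exact₁ hS M (Ext.mk₀ (ModuleCat.ofHom g))
        -- The obstruction to extending `g` from `I` to `A` lies in `Ext^1(A ⧸ I, M) = 0`.
        (add_zero 1) (Subsingleton.elim (α := Ext (ModuleCat.of A (A ⧸ I)) M 1) _ _)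
      obtain ⟨x, rfl⟩ := (Ext.mk₀_bijective _ _).2 x
      rw [Ext.mk₀_comp_mk₀] at hx
      have hx := (Ext.mk₀_bijective _ _).1 hx
      exact ⟨x.hom, fun y hy => congr($(hx).hom ⟨y, hy⟩)⟩
    infer_instance
  | succ n ih =>
    -- Embedding `M` in an injective shifts the vanishing range of the cokernel down by one.
    have hS : (ShortComplex.mk (Injective.ι M) (cokernel.π _) (cokernel.condition _)).ShortExact :=
      { exact := ShortComplex.exact_cokernel _ }
    refine hS.hasInjectiveDimensionLT_X₁ (n + 1) (ih _ fun I i hi => ?_)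
      (inferInstanceAs (HasInjectiveDimensionLT (Injective.under M) (n + 2)))
    obtain ⟨i, rfl⟩ : ∃ j, i = j + 1 := ⟨i - 1, by lia⟩
    refine subsingleton_of_forall_eq 0 fun e => ?_
    have := h I (i + 2) (by lia)
    obtain ⟨e', rfl⟩ := Ext.covariant_sequence_exact₃ _ hS e rfl
      (Subsingleton.elim (α := Ext (ModuleCat.of A (A ⧸ I)) M (i + 2)) _ _)
    rw [Ext.eq_zero_of_injective (I := Injective.under M) e', Ext.zero_comp]

end Baer

/-! ### Germs of morphisms as an invariant of a localization -/

section Germ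

variable {C : Type*} [Category* C] {D : Type u} [Category.{v} D] [Preadditive D]

/-- The contravariant functor (with values in an opposite category) that sends `X` to the germs
along a filter of families of morphisms from `F.obj X` to the objects `E i`. -/
def homGerm (F : C ⥤ D) (l : Filter ℤ) (E : ℤ → D) : C ⥤ (Type v)ᵒᵖ where
  obj X := .op (l.Product fun i => F.obj X ⟶ E i)
  map f := Quiver.Hom.op (TypeCat.ofHom (Quotient.map' (fun u i => F.map f ≫ u i)
    fun _ _ h => h.mono fun _ hi => congrArg _ hi))
  map_id X := by
    refine Quiver.Hom.unop_inj (TypeCat.homEquiv.injective (funext fun u => ?_))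
    induction u using Quotient.inductionOn' with | _ u
    exact Quotient.sound' (.of_forall fun i => by simp)
  map_comp f g := by
    refine Quiver.Hom.unop_inj (TypeCat.homEquiv.injective (funext fun u => ?_))
    induction u using Quotient.inductionOn' with | _ u
    exact Quotient.sound' (.of_forall fun i => by simp)

/-- The degree from which precomposition is bijective depends on `f`. Passing to germs absorbs this
dependence, so a single functor inverts all such `f` at once. -/
lemma isIso_homGerm_map (F : C ⥤ D) (l : Filter ℤ) (E : ℤ → D) {X Y : C} (f : X ⟶ Y)
    (h : ∀ᶠ i in l, Function.Bijective fun u : F.obj Y ⟶ E i => F.map f ≫ u) :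
    IsIso ((homGerm F l E).map f) := by
  suffices IsIso ((homGerm F l E).map f).unop from
    (isIso_unop_iff _).1 this
  rw [isIso_iff_bijective]
  constructor
  · intro a b hab
    induction a using Quotient.inductionOn' with | _ a
    induction b using Quotient.inductionOn' with | _ b
    have hab : ∀ᶠ i in l, F.map f ≫ a i = F.map f ≫ b i := Quotient.exact hab
    exact Quotient.sound' (by filter_upwards [h, hab] with i hi hi' using hi.1 hi')
  · intro b
    induction b using Quotient.inductionOn' with | _ b
    classical
    -- The value 0 is used where no preimage exists; this does not affect the germ.
    refine ⟨Quotient.mk'' fun i =>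
      if hi : ∃ u : F.obj Y ⟶ E i, F.map f ≫ u = b i then hi.choose else 0,
      Quotient.sound' ?_⟩
    filter_upwards [h] with i hi
    have hi' := hi.2 (b i)
    rw [dif_pos hi']
    exact hi'.choose_spec

lemma subsingleton_homGerm_obj_iff (F : C ⥤ D) (l : Filter ℤ) (E : ℤ → D) (X : C) :
    Subsingleton (l.Product fun i => F.obj X ⟶ E i) ↔
      ∀ᶠ i in l, Subsingleton (F.obj X ⟶ E i) := by
  constructor
  · intro h
    -- A family that is nonzero wherever the Hom group is nontrivial: if its germ is that of zero,
    -- the groups are eventually trivial.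
    have hne (i : ℤ) : ∃ u : F.obj X ⟶ E i, u = 0 → Subsingleton (F.obj X ⟶ E i) := by
      by_contra! hcon
      exact not_subsingleton_iff_nontrivial.2 (hcon 0).2
        (subsingleton_of_forall_eq 0 fun u => (hcon u).1)
    choose u hu using hne
    have h0 : ∀ᶠ i in l, u i = 0 :=
      Quotient.exact (Subsingleton.elim (α := l.Product fun i => F.obj X ⟶ E i)
        (Quotient.mk'' u) (Quotient.mk'' fun _ => 0))
    exact h0.mono fun i hi => hu i hi
  · refine fun h => ⟨fun a b => ?_⟩
    induction a using Quotient.inductionOn' with | _ a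
    induction b using Quotient.inductionOn' with | _ b
    exact Quotient.sound' (h.mono fun i hi => Subsingleton.elim _ _)

/-- Eventual vanishing of the morphisms to a family of objects is invariant under isomorphisms in
a localization at morphisms that eventually induce bijections. -/
lemma eventually_subsingleton_hom_of_iso_localization (F : C ⥤ D) (l : Filter ℤ) (E : ℤ → D)
    {W : MorphismProperty C}
    (hW : ∀ ⦃X Y : C⦄ (f : X ⟶ Y), W f →
      ∀ᶠ i in l, Function.Bijective fun u : F.obj Y ⟶ E i => F.map f ≫ u)
    {X Y : C} (e : W.Q.obj X ≅ W.Q.obj Y) (hX : ∀ᶠ i in l, Subsingleton (F.obj X ⟶ E i)) :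
    ∀ᶠ i in l, Subsingleton (F.obj Y ⟶ E i) := by
  have hG : W.IsInvertedBy (homGerm F l E) := fun _ _ f hf =>
    isIso_homGerm_map F l E f (hW f hf)
  rw [← subsingleton_homGerm_obj_iff] at hX ⊢
  -- The germ functor factors through the localization, so `e` becomes a bijection between germ
  -- sets.
  have e' := ((Localization.Construction.lift (homGerm F l E) hG).mapIso e).unop.toEquiv
  exact e'.symm.subsingleton_congr.1 hX

end Germ

namespace BrutalTruncation

/-! ### Maps to an object in one degree, modulo bounded complexes -/

section HomotopyCategory

variable {V : Type u} [Category.{v} V] [Preadditive V]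

lemma isKb_shift {Z : K V} (hZ : isKb V Z) (n : ℤ) : isKb V (Z⟦n⟧) := by
  obtain ⟨B, ⟨N, hN⟩, ⟨e⟩⟩ := hZ
  refine ⟨B⟦n⟧, ⟨|N| + |n|, fun i hi => hN (i + n) ?_⟩,
    ⟨(shiftFunctor (K V) n).mapIso e ≪≫
      ((HomotopyCategory.quotient V (ComplexShape.up ℤ)).commShiftIso n).symm.app B⟩⟩
  grind

variable [HasZeroObject V]

/-- The object `S`, placed in degree `i`, in the homotopy category. -/
noncomputable abbrev singleK (S : V) (i : ℤ) : K V :=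
  (HomotopyCategory.quotient V _).obj ((HomologicalComplex.single V (ComplexShape.up ℤ) i).obj S)

/-- The homotopy classes of maps from `C` to `S` in degree `i` vanish if and only if the complex
`Hom(C, S)` is exact there. -/
lemma subsingleton_hom_singleK_iff (C : CochainComplex V ℤ) (S : V) (i : ℤ) :
    Subsingleton ((HomotopyCategory.quotient V _).obj C ⟶ singleK S i) ↔
      ∀ φ : C.X i ⟶ S, C.d (i - 1) i ≫ φ = 0 → ∃ ψ : C.X (i + 1) ⟶ S, C.d i (i + 1) ≫ ψ = φ := by
  have h1 : (ComplexShape.up ℤ).Rel i (i + 1) := rfl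
  have h2 : (ComplexShape.up ℤ).Rel (i - 1) i := by simp
  let e := HomologicalComplex.singleObjXSelf (ComplexShape.up ℤ) i S
  constructor
  · intro h φ hφ
    let f : C ⟶ (HomologicalComplex.single V (ComplexShape.up ℤ) i).obj S :=
      HomologicalComplex.mkHomToSingle φ (fun j hj => by
        obtain rfl : j = i - 1 := by simp at hj; lia
        exact hφ)
    have hf : f.f i ≫ e.hom = φ := by simp [f, e]
    have hh := (HomotopyCategory.homotopyOfEq f 0 (Subsingleton.elim _ _)).comm i
    rw [dNext_eq _ h1, prevD_eq _ h2] at hh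
    refine ⟨(HomotopyCategory.homotopyOfEq f 0 (Subsingleton.elim _ _)).hom (i + 1) i ≫ e.hom, ?_⟩
    rw [← hf, hh]
    simp
  · intro h
    refine subsingleton_of_forall_eq 0 fun g => ?_
    obtain ⟨f, rfl⟩ := (HomotopyCategory.quotient V _).map_surjective g
    obtain ⟨ψ, hψ⟩ := h (f.f i ≫ e.hom) (by
      rw [← Category.assoc, ← f.comm]
      simp)
    rw [← (HomotopyCategory.quotient V (ComplexShape.up ℤ)).map_zero]
    -- The only nonzero component of the null homotopy is `ψ`, from degree `i + 1` to `i`; the other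
    -- term of the homotopy relation vanishes since the target has zero differential.
    refine HomotopyCategory.eq_of_homotopy _ _
      { hom := fun a b => if hab : a = i + 1 ∧ b = i then
          eqToHom (by rw [hab.1]) ≫ ψ ≫ e.inv ≫ eqToHom (by rw [hab.2]) else 0
        zero := fun a b hab => dif_neg (by rintro ⟨rfl, rfl⟩; exact hab rfl)
        comm := fun j => ?_ }
    by_cases hj : j = i
    · subst hj
      rw [dNext_eq _ h1, prevD_eq _ h2, dif_pos ⟨rfl, rfl⟩]
      simp [reassoc_of% hψ]
    · exact (HomologicalComplex.isZero_single_obj_X _ _ _ _ hj).eq_of_tgt _ _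

lemma subsingleton_hom_singleK_of_isZero {C : CochainComplex V ℤ} (S : V) {i : ℤ}
    (h : IsZero (C.X i)) :
    Subsingleton ((HomotopyCategory.quotient V _).obj C ⟶ singleK S i) :=
  (subsingleton_hom_singleK_iff C S i).2 fun _ _ => ⟨0, h.eq_of_src _ _⟩

lemma eventually_subsingleton_hom_singleK_of_isKb {Z : K V} (hZ : isKb V Z) (S : V) :
    ∀ᶠ i in Filter.atBot, Subsingleton (Z ⟶ singleK S i) := by
  obtain ⟨B, ⟨N, hN⟩, ⟨e⟩⟩ := hZ
  filter_upwards [Filter.eventually_le_atBot (-|N|)] with i hi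
  have := subsingleton_hom_singleK_of_isZero S (hN i ((le_abs_self N).trans
    ((le_neg.1 hi).trans (neg_le_abs i))))
  exact (e.homCongr (Iso.refl _)).subsingleton

variable [HasBinaryBiproducts V]

/-- A morphism with bounded cone induces bijections on the homotopy classes of maps to an object
in a sufficiently low degree. -/
lemma eventually_bijective_of_trW {X Y : K V} {f : X ⟶ Y} (hf : (isKb V).trW f) (S : V) :
    ∀ᶠ i in Filter.atBot, Function.Bijective fun u : Y ⟶ singleK S i => f ≫ u := by
  obtain ⟨Z, g, h, hT, hZ⟩ := hf
  -- Vanishing on the cone `Z` gives injectivity; vanishing on `Z⟦-1⟧`, the preceding term of the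
  -- triangle, gives surjectivity.
  filter_upwards [eventually_subsingleton_hom_singleK_of_isKb hZ S,
    eventually_subsingleton_hom_singleK_of_isKb (isKb_shift hZ (-1)) S] with i h0 h1
  constructor
  · intro a b hab
    obtain ⟨w, hw⟩ := Pretriangulated.Triangle.yoneda_exact₂ _ hT (a - b) (by
      change f ≫ (a - b) = 0
      rw [Preadditive.comp_sub, sub_eq_zero]
      exact hab)
    rw [Subsingleton.elim (α := Z ⟶ singleK S i) w 0] at hw
    exact sub_eq_zero.1 (hw.trans comp_zero)
  · intro s
    obtain ⟨w, hw⟩ := Pretriangulated.Triangle.yoneda_exact₂ _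
      (Pretriangulated.inv_rot_of_distTriang _ hT) s
      (Subsingleton.elim (α := (Z⟦(-1 : ℤ)⟧ ⟶ singleK S i)) _ _)
    exact ⟨w, hw.symm⟩

lemma eventually_subsingleton_hom_singleK_of_iso {X Y : Kminusb V}
    (e : (coneBounded V).Q.obj X ≅ (coneBounded V).Q.obj Y) (S : V)
    (hX : ∀ᶠ i in Filter.atBot, Subsingleton (X.obj ⟶ singleK S i)) :
    ∀ᶠ i in Filter.atBot, Subsingleton (Y.obj ⟶ singleK S i) :=
  eventually_subsingleton_hom_of_iso_localization (isKminusb V).ι _ (singleK S)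
    (fun _ _ _ hf => eventually_bijective_of_trW hf S) e hX

end HomotopyCategory

/-! ### Density forces exactness of `Hom(-, S)` in low degrees -/

section Exactness

variable {V : Type u} [Category.{v} V] [Preadditive V]

lemma homFrom_exactAt_iff (P : V) (C : CochainComplex V ℤ) (i : ℤ) :
    (homFrom P C).ExactAt i ↔ ∀ φ : P ⟶ C.X i, φ ≫ C.d i (i + 1) = 0 →
      ∃ ψ : P ⟶ C.X (i - 1), ψ ≫ C.d (i - 1) i = φ := by
  rw [HomologicalComplex.exactAt_iff' _ (i - 1) i (i + 1) (by simp) (by simp),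
    ShortComplex.ab_exact_iff]
  rfl

lemma homTo_exactAt_iff (P : V) (C : CochainComplex V ℤ) (i : ℤ) :
    (homTo C P).ExactAt i ↔ ∀ φ : C.X i ⟶ P, C.d (i - 1) i ≫ φ = 0 →
      ∃ ψ : C.X (i + 1) ⟶ P, C.d i (i + 1) ≫ ψ = φ := by
  -- `Hom(-, P)` reverses the shape, so degree `i + 1` precedes `i`.
  rw [HomologicalComplex.exactAt_iff' _ (i + 1) i (i - 1) (ComplexShape.prev_eq' _ rfl)
    (ComplexShape.next_eq' _ (show i - 1 + 1 = i by simp)),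
    ShortComplex.ab_exact_iff]
  rfl

variable [HasZeroObject V]

/-- For `i < n` the truncation agrees with `T` in the degrees `i - 1`, `i` and `i + 1`, so exactness
of `Hom(T, S)` at `i` transfers. At `i = n` the term in degree `i + 1` is cut off. -/
lemma subsingleton_hom_trunc_singleK {T : CochainComplex V ℤ} (hT : IsTotallyAcyclic T) (n : ℤ)
    (S : V) {i : ℤ} (hi : i < n) :
    Subsingleton ((HomotopyCategory.quotient V _).obj (trunc n T) ⟶ singleK S i) := by
  rw [subsingleton_hom_singleK_iff]
  intro φ hφ
  obtain ⟨ψ, hψ⟩ := (homTo_exactAt_iff S T i).1 (hT.2 S i) ((truncXIso n T hi.le).inv ≫ φ) (by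
    rw [← Category.assoc, ← truncXIso_inv_d n T (by lia) hi.le, Category.assoc, hφ, comp_zero])
  refine ⟨(truncXIso n T hi).hom ≫ ψ, ?_⟩
  rw [truncXIso_d_assoc n T hi.le hi, hψ, Iso.hom_inv_id_assoc]

/-- If the functor induced by truncation is dense, then every right bounded eventually acyclic
complex is eventually exact under the functors `Hom(-, S)`. -/
lemma eventually_exact_of_essSurj [HasBinaryBiproducts V] (h : (β V).EssSurj)
    {C : CochainComplex V ℤ} (h₁ : IsRightBounded C) (h₂ : IsEventuallyAcyclic C) (S : V) :
    ∀ᶠ i in Filter.atBot, ∀ φ : C.X i ⟶ S, C.d (i - 1) i ≫ φ = 0 →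
      ∃ ψ : C.X (i + 1) ⟶ S, C.d i (i + 1) ≫ ψ = φ := by
  let Y : Kminusb V := ⟨(HomotopyCategory.quotient V _).obj C, C, ⟨h₁, h₂⟩, ⟨Iso.refl _⟩⟩
  obtain ⟨T, ⟨e⟩⟩ := h.mem_essImage ((coneBounded V).Q.obj Y)
  refine (eventually_subsingleton_hom_singleK_of_iso (X := truncObj 0 T) e S ?_).mono
    fun i hi => (subsingleton_hom_singleK_iff C S i).1 hi
  filter_upwards [Filter.eventually_lt_atBot 0] with i hi
  exact subsingleton_hom_trunc_singleK (isTotallyAcyclic_as T.property) 0 S hi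

end Exactness

end BrutalTruncation

namespace BrutalTruncation

open Abelian

/-! ### Free resolutions and the computation of Ext -/

section FreeResolution

variable {A : Type u} [CommRing A]

/-- The number of generators in a chosen finite free cover. -/
noncomputable def coverRank (N : FGModuleCat.{u} A) : ℕ :=
  (Module.Finite.exists_fin' A N).choose

/-- A chosen finite free cover of a finite module. -/
noncomputable def coverMap (N : FGModuleCat.{u} A) : (Fin (coverRank N) → A) →ₗ[A] N :=
  (Module.Finite.exists_fin' A N).choose_spec.choose

lemma coverMap_surjective (N : FGModuleCat.{u} A) : Function.Surjective (coverMap N) :=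
  (Module.Finite.exists_fin' A N).choose_spec.choose_spec

variable [IsNoetherianRing A]

/-- The iterated syzygies of a finite module over a Noetherian ring. -/
noncomputable def syz (N : FGModuleCat.{u} A) : ℕ → FGModuleCat.{u} A
  | 0 => N
  | n + 1 => FGModuleCat.of A (LinearMap.ker (coverMap (syz N n)))

variable (N : FGModuleCat.{u} A)

/-- The inclusion of a syzygy into the preceding free module. -/
noncomputable def syzIncl (n : ℕ) : syz N (n + 1) →ₗ[A] (Fin (coverRank (syz N n)) → A) :=
  (LinearMap.ker (coverMap (syz N n))).subtype

lemma syzIncl_injective (n : ℕ) : Function.Injective (syzIncl N n) :=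
  Submodule.injective_subtype _

lemma exact_syzIncl_coverMap (n : ℕ) : Function.Exact (syzIncl N n) (coverMap (syz N n)) :=
  LinearMap.exact_subtype_ker_map _

lemma exact_resolution (n : ℕ) :
    Function.Exact (syzIncl N (n + 1) ∘ₗ coverMap (syz N (n + 2)))
      (syzIncl N n ∘ₗ coverMap (syz N (n + 1))) := by
  intro x
  rw [LinearMap.comp_apply, ← (syzIncl N n).map_zero, (syzIncl_injective N n).eq_iff,
    exact_syzIncl_coverMap N (n + 1) x]
  constructor
  · rintro ⟨y, rfl⟩
    obtain ⟨z, rfl⟩ := coverMap_surjective _ y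
    exact ⟨z, rfl⟩
  · rintro ⟨z, rfl⟩
    exact ⟨_, rfl⟩

/-- The free modules of the resolution. -/
noncomputable def resX (n : ℕ) : Proj A :=
  ⟨ModuleCat.of A (Fin (coverRank (syz N n)) → A),
    inferInstanceAs (Module.Finite A (Fin (coverRank (syz N n)) → A)),
    inferInstanceAs (Module.Projective A (Fin (coverRank (syz N n)) → A))⟩

/-- The differentials of the resolution. -/
noncomputable def resD (n : ℕ) : resX N (n + 1) ⟶ resX N n :=
  ObjectProperty.homMk (ModuleCat.ofHom (syzIncl N n ∘ₗ coverMap (syz N (n + 1))))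

/-- A resolution of a finite module by finite free modules. -/
noncomputable def resolution : ChainComplex (Proj A) ℕ :=
  ChainComplex.of (resX N) (resD N) fun n =>
    ObjectProperty.hom_ext _ (ModuleCat.hom_ext (exact_resolution N n).linearMap_comp_eq_zero)

lemma resolution_d (n : ℕ) : (resolution N).d (n + 1) n = resD N n :=
  ChainComplex.of_d _ _ _

/-- The resolution as a complex indexed by the integers. -/
noncomputable def cochainResolution : CochainComplex (Proj A) ℤ :=
  (resolution N).extend ComplexShape.embeddingDownNat

/-- The terms of `cochainResolution`. -/
noncomputable def cochainResolutionXIso {n : ℕ} {i : ℤ} (h : -(n : ℤ) = i) :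
    (cochainResolution N).X i ≅ resX N n :=
  (resolution N).extendXIso ComplexShape.embeddingDownNat h

lemma cochainResolution_d {n : ℕ} {i j : ℤ} (hi : -((n + 1 : ℕ) : ℤ) = i) (hj : -(n : ℤ) = j) :
    (cochainResolution N).d i j =
      (cochainResolutionXIso N hi).hom ≫ resD N n ≫ (cochainResolutionXIso N hj).inv := by
  rw [← resolution_d]
  exact (resolution N).extend_d_eq ComplexShape.embeddingDownNat hi hj

lemma isRightBounded_cochainResolution : IsRightBounded (cochainResolution N) :=
  ⟨1, fun i hi => (resolution N).isZero_extend_X _ _ fun n hn => by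
    change -(n : ℤ) = i at hn
    lia⟩

/-- Since `syzIncl` is injective, `φ` lands in the kernel of the cover, which is the next syzygy;
projectivity of `P` lifts it through the next cover. -/
lemma exists_lift_resD {P : Proj A} (n : ℕ) (φ : P ⟶ resX N (n + 1)) (h : φ ≫ resD N n = 0) :
    ∃ ψ : P ⟶ resX N (n + 2), ψ ≫ resD N (n + 1) = φ := by
  have hP := P.property.2
  have hmem (x : P.obj) : φ.hom.hom x ∈ LinearMap.ker (coverMap (syz N (n + 1))) :=
    syzIncl_injective N n (by
      rw [map_zero]
      exact congr($(h).hom.hom x))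
  let φ' : P.obj →ₗ[A] syz N (n + 2) := φ.hom.hom.codRestrict _ hmem
  obtain ⟨ψ, hψ⟩ := Module.projective_lifting_property (coverMap (syz N (n + 2))) φ'
    (coverMap_surjective _)
  refine ⟨ObjectProperty.homMk (ModuleCat.ofHom ψ), ObjectProperty.hom_ext _ (ModuleCat.hom_ext
    (LinearMap.ext fun x => ?_))⟩
  exact congr(syzIncl N (n + 1) ($hψ x))

lemma isEventuallyAcyclic_cochainResolution : IsEventuallyAcyclic (cochainResolution N) := by
  -- The bound 1 excludes only degree 0, whose homology `Hom(P, N)` need not vanish.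
  refine fun P => ⟨1, fun i hi => ?_⟩
  obtain h | h : 1 ≤ i ∨ i ≤ -1 := by grind
  · refine (homFrom_exactAt_iff _ _ _).2 fun φ _ => ⟨0, IsZero.eq_of_tgt ?_ _ _⟩
    exact (resolution N).isZero_extend_X _ _ fun n hn => by
      change -(n : ℤ) = i at hn
      lia
  · obtain ⟨n, rfl⟩ : ∃ n : ℕ, i = -((n + 1 : ℕ) : ℤ) := ⟨(-i - 1).toNat, by lia⟩
    rw [homFrom_exactAt_iff]
    intro φ hφ
    have hn2 : -((n + 2 : ℕ) : ℤ) = -((n + 1 : ℕ) : ℤ) - 1 := by lia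
    have hn0 : -(n : ℤ) = -((n + 1 : ℕ) : ℤ) + 1 := by lia
    rw [cochainResolution_d N rfl hn0] at hφ
    obtain ⟨ψ, hψ⟩ := exists_lift_resD N n (φ ≫ (cochainResolutionXIso N rfl).hom) (by
      rw [← cancel_mono (cochainResolutionXIso N hn0).inv]
      simpa using hφ)
    refine ⟨ψ ≫ (cochainResolutionXIso N hn2).inv, ?_⟩
    rw [cochainResolution_d N hn2 rfl, Category.assoc, Iso.inv_hom_id_assoc, ← Category.assoc, hψ,
      Category.assoc, Iso.hom_inv_id, Category.comp_id]

/-- The presentation of a syzygy by the next one. -/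
noncomputable abbrev syzShortComplex (n : ℕ) : ShortComplex (ModuleCat.{u} A) :=
  ShortComplex.moduleCatMk (syzIncl N n) (coverMap (syz N n))
    (exact_syzIncl_coverMap N n).linearMap_comp_eq_zero

lemma syzShortComplex_shortExact (n : ℕ) : (syzShortComplex N n).ShortExact where
  exact := (ShortComplex.ShortExact.moduleCat_exact_iff_function_exact _).2
    (exact_syzIncl_coverMap N n)
  mono_f := (ModuleCat.mono_iff_injective _).2 (syzIncl_injective N n)
  epi_g := (ModuleCat.epi_iff_surjective _).2 (coverMap_surjective _)

instance (n : ℕ) : Projective (syzShortComplex N n).X₂ :=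
  inferInstanceAs (Projective (ModuleCat.of A (Fin (coverRank (syz N n)) → A)))

/-- Dimension shifting. -/
lemma subsingleton_ext_of_syz (M : ModuleCat.{u} A) (n i : ℕ)
    (h : Subsingleton (Ext (syz N n).obj M (i + 1))) :
    Subsingleton (Ext N.obj M (n + i + 1)) := by
  induction n generalizing i with
  | zero => rwa [zero_add]
  | succ n ih =>
    have : Subsingleton (Ext (syzShortComplex N n).X₁ M (i + 1)) := h
    -- The connecting map `Ext^(i+1)(syz (n+1), M) → Ext^(i+2)(syz n, M)` is onto because the middle
    -- term is free.
    have := ih (i + 1) (precomp_extClass_surjective_of_projective_X₂ M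
      (syzShortComplex_shortExact N n) (i + 1)).subsingleton
    rwa [show n + 1 + i + 1 = n + (i + 1) + 1 by lia]

/-- `A` as an object of the category of finitely generated projective modules. -/
noncomputable abbrev projSelf (A : Type u) [CommRing A] : Proj A :=
  ⟨ModuleCat.of A A, inferInstanceAs (Module.Finite A A), inferInstanceAs (Module.Projective A A)⟩

/-- A class in this `Ext^1` is the image of a map `f` on the next syzygy, and dies once `f` extends
to the free module. Composed with the cover, `f` is a cocycle; a cochain `ψ` bounding it is such an
extension, as the cover is onto. -/
lemma subsingleton_ext_one_syz (n : ℕ)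
    (h : ∀ φ : resX N (n + 1) ⟶ projSelf A, resD N (n + 1) ≫ φ = 0 →
      ∃ ψ : resX N n ⟶ projSelf A, resD N n ≫ ψ = φ) :
    Subsingleton (Ext (syz N n).obj (ModuleCat.of A A) 1) := by
  refine subsingleton_of_forall_eq 0 fun e => ?_
  obtain ⟨x, rfl⟩ := precomp_extClass_surjective_of_projective_X₂ (ModuleCat.of A A)
    (syzShortComplex_shortExact N n) 0 e
  obtain ⟨f, rfl⟩ := (Ext.mk₀_bijective _ _).2 x
  obtain ⟨ψ, hψ⟩ := h (ObjectProperty.homMk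
    (ModuleCat.ofHom (f.hom ∘ₗ coverMap (syz N (n + 1))))) (by
      refine ObjectProperty.hom_ext _ (ModuleCat.hom_ext (LinearMap.ext fun x => ?_))
      change f.hom (coverMap (syz N (n + 1)) (syzIncl N (n + 1) _)) = 0
      rw [(exact_syzIncl_coverMap N (n + 1)).apply_apply_eq_zero]
      exact f.hom.map_zero)
  obtain ⟨g, hg⟩ : ∃ g : (syzShortComplex N n).X₂ ⟶ ModuleCat.of A A,
      (syzShortComplex N n).f ≫ g = f := by
    refine ⟨ψ.hom, ModuleCat.hom_ext (LinearMap.ext fun y => ?_)⟩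
    obtain ⟨z, rfl⟩ := coverMap_surjective _ y
    exact congr($(hψ).hom.hom z)
  have hzero : (syzShortComplex_shortExact N n).extClass.comp
      (Ext.mk₀ ((syzShortComplex N n).f ≫ g)) (add_zero 1) = 0 := by
    rw [← Ext.mk₀_comp_mk₀, ← Ext.comp_assoc_of_second_deg_zero,
      ShortComplex.ShortExact.extClass_comp, Ext.zero_comp]
  rw [hg] at hzero
  exact hzero

/-- If the functor induced by truncation is dense, then `Ext^i(N, A)` vanishes for large `i`. -/
lemma eventually_subsingleton_ext_of_essSurj (h : (βProj A).EssSurj) :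
    ∃ m : ℕ, ∀ i, m ≤ i → Subsingleton (Ext N.obj (ModuleCat.of A A) i) := by
  obtain ⟨b, hb⟩ := Filter.eventually_atBot.1 (eventually_exact_of_essSurj h
    (isRightBounded_cochainResolution N) (isEventuallyAcyclic_cochainResolution N) (projSelf A))
  -- `Ext^(n+1)` is governed by exactness in degree `-(n + 1)`, which must be at most `b`; the extra
  -- 1 ensures that `i` is positive.
  refine ⟨b.natAbs + 1, fun i hi => ?_⟩
  obtain ⟨n, rfl⟩ : ∃ n, i = n + 0 + 1 := ⟨i - 1, by lia⟩
  refine subsingleton_ext_of_syz N _ n 0 (subsingleton_ext_one_syz N n fun φ hφ => ?_)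
  have hn2 : -((n + 2 : ℕ) : ℤ) = -((n + 1 : ℕ) : ℤ) - 1 := by lia
  have hn0 : -(n : ℤ) = -((n + 1 : ℕ) : ℤ) + 1 := by lia
  obtain ⟨ψ, hψ⟩ := hb (-((n + 1 : ℕ) : ℤ)) (by lia) ((cochainResolutionXIso N rfl).hom ≫ φ) (by
    rw [cochainResolution_d N hn2 rfl]
    simp [hφ])
  refine ⟨(cochainResolutionXIso N hn0).inv ≫ ψ, ?_⟩
  rw [cochainResolution_d N rfl hn0] at hψ
  simpa using hψ

end FreeResolution

end BrutalTruncation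

theorem corollary2p5 (A : Type u) [CommRing A] [IsNoetherianRing A] [IsLocalRing A]
    (h : (BrutalTruncation.βProj A).EssSurj) :
    BrutalTruncation.IsGorensteinLocal A := by
  obtain ⟨m, hm⟩ := BrutalTruncation.eventually_subsingleton_ext_of_essSurj
    (FGModuleCat.of A (A ⧸ IsLocalRing.maximalIdeal A)) h
  exact ⟨m, hasInjectiveDimensionLT_of_subsingleton_ext_quotient m _ fun I i hi =>
    subsingleton_ext_of_residueField _ m hm _ i (m.le_succ.trans hi)⟩
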